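/- Let $d\ge 1$ be an integer and $L>0$. Let $\|g\|^2=\int_{\mathbb R^d}g(x)^2\,dx$ and let $\mathcal P_0=\mathcal P_0(d,L)$ be the class of all probability densities $p$ on $\mathbb R^d$ with $\|p\|_\infty\le L$. For $p\in\mathcal P_0$ let $X_1,\dots,X_n$ be i.i.d. with density $p$. An estimator is a jointly measurable function $T_n=T_n(x;X_1,\dots,X_n)$, $x\in\mathbb R^d$, and its risk is $R_n(T_n,p)=E_p^n\|T_n-p\|^2\in[0,\infty]$. For $f=(f_1,\dots,f_M)$ with $f_j\in L_2(\mathbb R^d)$ put $$\mathcal E_n(T_n;f)=\sup_{p\in\mathcal P_0}\Big[R_n(T_n,p)-\inf_{\lambda\in\mathbb R^M}\Big\|\sum_{j=1}^M\lambda_jf_j-p\Big\|^2\Big].$$ For every $c_0>0$ there are constants $0<C<\infty$ and $c>0$, depending only on $c_0$, such that for all integers $d\ge1$ and all $L>0$ the following holds: $LM/n$ is the optimal rate of linear aggregation over $\mathcal P_0$ in the range $M\le c_0n$, that is, 1. for every $M\ge2$ and all $f_1,\dots,f_M\in L_2(\mathbb R^d)$ there are estimators $\tilde p_n$, $n\ge1$,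 with $\mathcal E_n(\tilde p_n;f)\le C\,LM/n$ for every $n\ge1$; 2. for every $M\ge2$ there are $f_1,\dots,f_M\in L_2(\mathbb R^d)$ such that $\mathcal E_n(T_n;f)\ge c\,LM/n$ for every $n\ge1$ with $M\le c_0n$ and every estimator $T_n$ based on $X_1,\dots,X_n$. Moreover, the linear aggregate is rate optimal: for every $M\ge2$, all $f_1,\dots,f_M\in L_2(\mathbb R^d)$ and every orthonormal basis $\phi_1,\dots,\phi_{M'}$ in $L_2(\mathbb R^d)$ of the linear span of $f_1,\dots,f_M$, the estimators $$\tilde p_n^{\mathbf L}(x)=\sum_{j=1}^{M'}\Big(\frac1n\sum_{i=1}^n\phi_j(X_i)\Big)\phi_j(x),\qquad n\ge1,$$ satisfy the bound of item 1, $\mathcal E_n(\tilde p_n^{\mathbf L};f)\le C\,LM/n$ for every $n\ge1$. -/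

import Mathlib

open MeasureTheory Set
open scoped ENNReal

noncomputable section

namespace DensityAggregation

/-- The space `ℝ^d`, with its Borel structure and Lebesgue measure `volume`. -/
abbrev E (d : ℕ) : Type := EuclideanSpace ℝ (Fin d)

/-- The squared norm `‖g‖² = ∫ g(x)² dx` of `L₂(ℝ^d)`, with value `∞` outside `L₂(ℝ^d)`. -/
def sqNorm {d : ℕ} (g : E d → ℝ) : ℝ≥0∞ := ∫⁻ x, ‖g x‖ₑ ^ 2

/-- The class of all probability densities on `ℝ^d` whose `L_∞` norm is at most `L`. -/
def boundedDensities (d : ℕ) (L : ℝ) : Set (E d → ℝ) :=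
  {p | (∀ x, 0 ≤ p x) ∧ Integrable p ∧ ∫ x, p x = 1 ∧ eLpNorm p ∞ volume ≤ ENNReal.ofReal L}

/-- The law of an i.i.d. sample `(X_1, …, X_n)` with common Lebesgue density `p`. -/
def sampleLaw {d : ℕ} (n : ℕ) (p : E d → ℝ) : Measure (Fin n → E d) :=
  Measure.pi fun _ => volume.withDensity fun x => ENNReal.ofReal (p x)

/-- An estimator based on a sample of size `n`: to a sample it attaches a function on `ℝ^d`,
in a jointly (Lebesgue) measurable way. -/
def IsEstimator {d n : ℕ} (T : (Fin n → E d) → E d → ℝ) : Prop :=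
  AEMeasurable (Function.uncurry T) volume

/-- The `L₂`-risk `R_n(T, p) = E_p^n ‖T - p‖²`, possibly infinite. -/
def risk {d n : ℕ} (T : (Fin n → E d) → E d → ℝ) (p : E d → ℝ) : ℝ≥0∞ :=
  ∫⁻ ω, sqNorm (fun x => T ω x - p x) ∂(sampleLaw n p)

/-- The linear combination `∑ j, w_j f_j`. -/
def linComb {d M : ℕ} (f : Fin M → E d → ℝ) (w : Fin M → ℝ) (x : E d) : ℝ :=
  ∑ j, w j * f j x

/-- The oracle risk `inf_{w ∈ H} ‖∑ j, w_j f_j - p‖²`. -/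
def oracleRisk {d M : ℕ} (f : Fin M → E d → ℝ) (H : Set (Fin M → ℝ)) (p : E d → ℝ) : ℝ≥0∞ :=
  ⨅ w ∈ H, sqNorm (fun x => linComb f w x - p x)

/-- The maximal excess risk `sup_{p ∈ P} [R_n(T, p) - inf_{w ∈ H} ‖∑ j, w_j f_j - p‖²]`, as an
extended real number. The subtracted term is finite as soon as `H` is nonempty, the `f_j` are in
`L₂(ℝ^d)` and the densities in `P` are in `L₂(ℝ^d)`. -/
def maxExcessRisk {d M n : ℕ} (P : Set (E d → ℝ)) (H : Set (Fin M → ℝ))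
    (f : Fin M → E d → ℝ) (T : (Fin n → E d) → E d → ℝ) : EReal :=
  ⨆ p ∈ P, ((risk T p : ℝ≥0∞) : EReal) - ((oracleRisk f H p : ℝ≥0∞) : EReal)

/-- The upper bound in the definition of an optimal rate: `T n`, `n ≥ 1`, are estimators whose
maximal excess risk with respect to `f` is at most `C ψ_n(M)` for every `n ≥ 1`. -/
def AttainsRate {d M : ℕ} (P : Set (E d → ℝ)) (H : Set (Fin M → ℝ)) (ψ : ℕ → ℕ → ℝ) (C : ℝ)
    (f : Fin M → E d → ℝ) (T : ∀ n : ℕ, (Fin n → E d) → E d → ℝ) : Prop :=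
  ∀ n : ℕ, 1 ≤ n → IsEstimator (T n) ∧ maxExcessRisk P H f (T n) ≤ ((C * ψ n M : ℝ) : EReal)

/-- The lower bound in the definition of an optimal rate: no estimator has maximal excess risk
with respect to `f` smaller than `c ψ_n(M)`, for every `n ≥ 1` such that the pair `(n, M)` belongs
to the range `A`. -/
def RateUnimprovable {d M : ℕ} (P : Set (E d → ℝ)) (H : Set (Fin M → ℝ)) (ψ : ℕ → ℕ → ℝ)
    (A : ℕ → ℕ → Prop) (c : ℝ) (f : Fin M → E d → ℝ) : Prop :=
  ∀ n : ℕ, 1 ≤ n → A n M → ∀ T : (Fin n → E d) → E d → ℝ, IsEstimator T →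
    ((c * ψ n M : ℝ) : EReal) ≤ maxExcessRisk P H f T

/-- `ψ_n(M)`, `M ≥ 2`, is an optimal rate of aggregation for the sets of weights `H M ⊆ ℝ^M` over
the class `P`, in the range `A` of pairs `(n, M)`, with constants `C` (upper bound) and `c` (lower
bound); these do not depend on `n` and `M`. -/
structure IsOptimalRate {d : ℕ} (P : Set (E d → ℝ)) (H : ∀ M : ℕ, Set (Fin M → ℝ))
    (ψ : ℕ → ℕ → ℝ) (A : ℕ → ℕ → Prop) (C c : ℝ) : Prop where
  pos : ∀ n M : ℕ, 1 ≤ n → 2 ≤ M → 0 < ψ n M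
  upper : ∀ M : ℕ, 2 ≤ M → ∀ f : Fin M → E d → ℝ, (∀ j, MemLp (f j) 2 volume) →
    ∃ T : ∀ n : ℕ, (Fin n → E d) → E d → ℝ, AttainsRate P (H M) ψ C f T
  lower : ∀ M : ℕ, 2 ≤ M → ∃ f : Fin M → E d → ℝ, (∀ j, MemLp (f j) 2 volume) ∧
    RateUnimprovable P (H M) ψ A c f

/-- The functions `φ_1, …, φ_{M'}` form an orthonormal basis, in `L₂(ℝ^d)`, of the linear span of
`f_1, …, f_M`. -/
def IsOrthonormalBasisOfSpan {d M M' : ℕ} (f : Fin M → E d → ℝ)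
    (hf : ∀ j, MemLp (f j) 2 volume) (φ : Fin M' → E d → ℝ) : Prop :=
  ∃ hφ : ∀ j, MemLp (φ j) 2 volume,
    Orthonormal ℝ (fun j => (hφ j).toLp (φ j)) ∧
    Submodule.span ℝ (range fun j => (hφ j).toLp (φ j)) =
      Submodule.span ℝ (range fun j => (hf j).toLp (f j))

/-- The linear aggregate `∑ j, ((1/n) ∑ i, φ_j(X_i)) φ_j`. -/
def linearAggregate {d M' : ℕ} (φ : Fin M' → E d → ℝ) (n : ℕ) (X : Fin n → E d) (x : E d) : ℝ :=
  ∑ j, ((1 / (n : ℝ)) * ∑ i, φ j (X i)) * φ j x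

end DensityAggregation

end

noncomputable section

namespace DensityAggregation

open ProbabilityTheory

variable {d : ℕ}

/-! ### The squared norm and the Hilbert space `L₂` -/

/-! Upper bound. In an orthonormal basis `φ` of the span, Pythagoras (`norm_sum_smul_sub_sq`) splits
the loss into the squared errors of the `M'` coefficients plus the squared distance from `p` to the
span, which is at most the oracle risk. The coefficient `⟨φ_j, p⟩` is the mean of `φ_j(X)`, so its
empirical mean is unbiased with variance at most `(1/n) ∫ φ_j² p ≤ L/n`. Since `M' ≤ M`, this gives
`C = 1`.

Lower bound. Take `m = M - 1` pairs of disjoint boxes of volume `1/(mL)`, and densities equal to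
`L(1 ± ε)/2` on the two halves of each pair, the sign pattern being a vertex of `{±1}^m`. All of
them lie in the span of `M` fixed step functions, so the oracle risk vanishes and the excess risk is
the risk. Flipping one sign keeps the `n`-sample Hellinger affinity above `3/4` when `nε² ≤ m/4`, so
Le Cam's bound on each pair (`two_point_bound`) and averaging over vertices (`exists_le_of_flip`)
give risk at least `Lε²/8` at some vertex. The choice `ε² ≍ M/n` gives the rate. -/

theorem sqNorm_eq_norm_toLp_sq {g : E d → ℝ} (hg : MemLp g 2 volume) :
    sqNorm g = ENNReal.ofReal (‖hg.toLp g‖ ^ 2) := by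
  rw [Lp.norm_toLp, ENNReal.ofReal_pow ENNReal.toReal_nonneg,
    ENNReal.ofReal_toReal hg.eLpNorm_ne_top]
  have h := eLpNorm_nnreal_pow_eq_lintegral (f := g) (μ := (volume : Measure (E d)))
    (p := 2) two_ne_zero
  simp only [NNReal.coe_ofNat, ENNReal.coe_ofNat, ENNReal.rpow_ofNat] at h
  exact h.symm

theorem sqNorm_congr_ae {g h : E d → ℝ} (hgh : g =ᵐ[volume] h) : sqNorm g = sqNorm h :=
  lintegral_congr_ae (hgh.mono fun x hx => by simp only [hx])

theorem memLp_linComb {M : ℕ} {f : Fin M → E d → ℝ} (hf : ∀ j, MemLp (f j) 2 volume)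
    (w : Fin M → ℝ) : MemLp (linComb f w) 2 volume :=
  memLp_finsetSum Finset.univ fun j _ => (hf j).const_mul (w j)

theorem toLp_linComb {M : ℕ} {f : Fin M → E d → ℝ} (hf : ∀ j, MemLp (f j) 2 volume)
    (w : Fin M → ℝ) :
    (memLp_linComb hf w).toLp (linComb f w) = ∑ j, w j • (hf j).toLp (f j) := by
  apply Lp.ext
  refine (MemLp.coeFn_toLp _).trans ?_
  have h1 := Lp.coeFn_finsetSum Finset.univ fun j => w j • (hf j).toLp (f j)
  have h2 : ∀ᵐ x, ∀ j, (w j • (hf j).toLp (f j) : Lp ℝ 2 (volume : Measure (E d))) x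
      = w j * f j x := by
    rw [ae_all_iff]
    intro j
    filter_upwards [Lp.coeFn_smul (w j) ((hf j).toLp (f j)), (hf j).coeFn_toLp] with x h3 h4
    simp [h3, h4]
  filter_upwards [h1, h2] with x h1 h2
  rw [h1]
  simp [linComb, h2]

theorem sqNorm_linComb_sub {M : ℕ} {f : Fin M → E d → ℝ} (hf : ∀ j, MemLp (f j) 2 volume)
    (w : Fin M → ℝ) {p : E d → ℝ} (hp : MemLp p 2 volume) :
    sqNorm (fun x => linComb f w x - p x) =
      ENNReal.ofReal (‖∑ j, w j • (hf j).toLp (f j) - hp.toLp p‖ ^ 2) := by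
  rw [← toLp_linComb, ← MemLp.toLp_sub]
  exact sqNorm_eq_norm_toLp_sq _

/-- Pythagoras' identity for the approximation by an orthonormal system. -/
theorem norm_sum_smul_sub_sq {H ι : Type*} [NormedAddCommGroup H] [InnerProductSpace ℝ H]
    [Fintype ι] {e : ι → H} (he : Orthonormal ℝ e) (F : H) (w : ι → ℝ) :
    ‖∑ j, w j • e j - F‖ ^ 2 =
      ∑ j, (w j - inner ℝ (e j) F) ^ 2 + ‖∑ j, inner ℝ (e j) F • e j - F‖ ^ 2 := by
  classical
  -- Applied both to `w` and to the projection coefficients; the difference is a completed square.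
  have key : ∀ u : ι → ℝ, ‖∑ j, u j • e j - F‖ ^ 2 =
      ∑ j, u j ^ 2 - 2 * ∑ j, u j * inner ℝ (e j) F + ‖F‖ ^ 2 := by
    intro u
    rw [norm_sub_sq_real, sum_inner, ← real_inner_self_eq_norm_sq, he.inner_sum]
    simp [real_inner_smul_left, sq]
  rw [key, key, ← add_assoc, add_left_inj]
  simp only [Finset.mul_sum, ← Finset.sum_sub_distrib, ← Finset.sum_add_distrib]
  exact Finset.sum_congr rfl fun j _ => by ring

/-! ### The sampling distribution -/

section density

variable {L : ℝ} {p : E d → ℝ}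

/-- The law with Lebesgue density `p`. -/
abbrev densityLaw (p : E d → ℝ) : Measure (E d) :=
  volume.withDensity fun x => ENNReal.ofReal (p x)

theorem ae_le_of_mem_boundedDensities (hL : 0 ≤ L) (hp : p ∈ boundedDensities d L) :
    ∀ᵐ x, p x ≤ L := by
  have h := hp.2.2.2
  rw [eLpNorm_exponent_top] at h
  filter_upwards [ae_le_eLpNormEssSup (f := p) (μ := volume)] with x hx
  have := hx.trans h
  rw [← ofReal_norm, ENNReal.ofReal_le_ofReal_iff hL] at this
  exact (le_abs_self _).trans this

theorem isProbabilityMeasure_densityLaw (hp : p ∈ boundedDensities d L) :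
    IsProbabilityMeasure (densityLaw p) := by
  constructor
  rw [withDensity_apply _ MeasurableSet.univ, Measure.restrict_univ,
    ← ofReal_integral_eq_lintegral_ofReal hp.2.1 (ae_of_all _ hp.1), hp.2.2.1, ENNReal.ofReal_one]

/-- This domination makes `L₂` functions square integrable under the sampling law and bounds second
moments by `L ‖g‖²`. -/
theorem densityLaw_le (hL : 0 ≤ L) (hp : p ∈ boundedDensities d L) :
    densityLaw p ≤ ENNReal.ofReal L • volume := by
  rw [← withDensity_const]
  exact withDensity_mono ((ae_le_of_mem_boundedDensities hL hp).mono fun x hx =>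
    ENNReal.ofReal_le_ofReal hx)

theorem memLp_two_of_mem_boundedDensities (hL : 0 ≤ L) (hp : p ∈ boundedDensities d L) :
    MemLp p 2 volume := by
  rw [memLp_two_iff_integrable_sq hp.2.1.aestronglyMeasurable]
  refine (hp.2.1.const_mul L).mono' (hp.2.1.aestronglyMeasurable.pow 2) ?_
  filter_upwards [ae_le_of_mem_boundedDensities hL hp] with x hx
  rw [Real.norm_of_nonneg (sq_nonneg _), sq]
  exact mul_le_mul_of_nonneg_right hx (hp.1 x)

theorem memLp_densityLaw (hL : 0 ≤ L) (hp : p ∈ boundedDensities d L) {g : E d → ℝ}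
    (hg : MemLp g 2 volume) : MemLp g 2 (densityLaw p) :=
  (hg.smul_measure ENNReal.ofReal_ne_top).mono_measure (densityLaw_le hL hp)

theorem integral_densityLaw (hp : p ∈ boundedDensities d L) (g : E d → ℝ) :
    ∫ x, g x ∂(densityLaw p) = ∫ x, p x * g x := by
  rw [integral_withDensity_eq_integral_toReal_smul₀ hp.2.1.aemeasurable.ennreal_ofReal
    (ae_of_all _ fun _ => ENNReal.ofReal_lt_top)]
  simp only [ENNReal.toReal_ofReal (hp.1 _), smul_eq_mul]

/-- The reason why projection coefficients can be estimated by sample means. -/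
theorem inner_toLp_eq_integral_densityLaw (hp : p ∈ boundedDensities d L)
    (hp2 : MemLp p 2 volume) {g : E d → ℝ} (hg : MemLp g 2 volume) :
    inner ℝ (hg.toLp g) (hp2.toLp p) = ∫ x, g x ∂(densityLaw p) := by
  rw [integral_densityLaw hp, L2.inner_def]
  refine integral_congr_ae ?_
  filter_upwards [hg.coeFn_toLp, hp2.coeFn_toLp] with x h1 h2
  simp [h1, h2]

theorem variance_densityLaw_le (hL : 0 ≤ L) (hp : p ∈ boundedDensities d L) {g : E d → ℝ}
    (hg : MemLp g 2 volume) (hg1 : ‖hg.toLp g‖ = 1) : Var[g; densityLaw p] ≤ L := by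
  have := isProbabilityMeasure_densityLaw hp
  refine (variance_le_expectation_sq (memLp_densityLaw hL hp hg).1).trans ?_
  have h1 : ∫ x, g x ^ 2 = 1 := by
    have : inner ℝ (hg.toLp g) (hg.toLp g) = (1 : ℝ) := by
      rw [real_inner_self_eq_norm_sq, hg1, one_pow]
    rw [← this, L2.inner_def]
    refine integral_congr_ae ?_
    filter_upwards [hg.coeFn_toLp] with x h
    simp [h]
  calc ∫ x, (g ^ 2) x ∂(densityLaw p) ≤ ∫ x, (g ^ 2) x ∂(ENNReal.ofReal L • volume) :=
        integral_mono_measure (densityLaw_le hL hp) (ae_of_all _ fun x => sq_nonneg (g x))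
          (hg.integrable_sq.smul_measure ENNReal.ofReal_ne_top)
    _ = L := by simp [integral_smul_measure, h1, hL]

end density

/-! ### The linear aggregate -/

section linearAggregate

variable {L : ℝ} {p : E d → ℝ} {n : ℕ}

/-- The empirical mean `(1/n) ∑ i, g(X_i)`. -/
def empMean (g : E d → ℝ) (n : ℕ) (X : Fin n → E d) : ℝ := (1 / (n : ℝ)) * ∑ i, g (X i)

/-- By unbiasedness the mean squared error is the variance, and independence divides that of one
observation by `n`. -/
theorem lintegral_empMean_sub_sq_le (hL : 0 ≤ L) (hn : 1 ≤ n) (hp : p ∈ boundedDensities d L)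
    {g : E d → ℝ} (hg : MemLp g 2 volume) (hg1 : ‖hg.toLp g‖ = 1) :
    ∫⁻ X, ENNReal.ofReal ((empMean g n X - ∫ x, g x ∂(densityLaw p)) ^ 2) ∂(sampleLaw n p)
      ≤ ENNReal.ofReal (L / n) := by
  have := isProbabilityMeasure_densityLaw hp
  have hgp := memLp_densityLaw hL hp hg
  have hn0 : (n : ℝ) ≠ 0 := by positivity
  have hev : ∀ i : Fin n, MemLp (fun X : Fin n → E d => g (X i)) 2 (sampleLaw n p) := fun i =>
    hgp.comp_measurePreserving (measurePreserving_eval _ i)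
  have hmem : MemLp (empMean g n) 2 (sampleLaw n p) :=
    (memLp_finsetSum Finset.univ fun i _ => hev i).const_mul _
  have : IsProbabilityMeasure (sampleLaw n p) := by unfold sampleLaw; infer_instance
  have hmean : ∫ X, empMean g n X ∂(sampleLaw n p) = ∫ x, g x ∂(densityLaw p) := by
    unfold empMean
    rw [integral_const_mul, integral_finsetSum _ fun i _ => (hev i).integrable one_le_two]
    have : ∀ i : Fin n, ∫ X, g (X i) ∂(sampleLaw n p) = ∫ x, g x ∂(densityLaw p) := fun i =>
      integral_comp_eval (μ := fun _ : Fin n => densityLaw p) hgp.1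
    simp only [this, Finset.sum_const, Finset.card_univ, Fintype.card_fin, nsmul_eq_mul]
    field_simp
  rw [← hmean, ← evariance_eq_lintegral_ofReal, ← ofReal_variance hmem]
  apply ENNReal.ofReal_le_ofReal
  have h1 : Var[empMean g n; sampleLaw n p] = (1 / (n : ℝ)) ^ 2 * (n * Var[g; densityLaw p]) := by
    have hs : empMean g n = fun X => (1 / (n : ℝ)) * (∑ i, fun X : Fin n → E d => g (X i)) X := by
      ext X; simp [empMean]
    rw [hs, variance_const_mul]
    congr 1
    unfold sampleLaw
    rw [variance_sum_pi (X := fun _ : Fin n => g) fun _ => hgp]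
    simp
  rw [h1]
  have h2 := variance_densityLaw_le hL hp hg hg1
  calc (1 / (n : ℝ)) ^ 2 * (n * Var[g; densityLaw p]) = Var[g; densityLaw p] / n := by
        field_simp
    _ ≤ L / n := by gcongr

theorem isEstimator_linearAggregate {M' : ℕ} {φ : Fin M' → E d → ℝ}
    (hφ : ∀ j, MemLp (φ j) 2 volume) (n : ℕ) : IsEstimator (linearAggregate φ n) := by
  have h1 : ∀ j (i : Fin n), AEMeasurable
      (fun z : (Fin n → E d) × E d => φ j (z.1 i)) volume := fun j i =>
    (hφ j).1.aemeasurable.comp_quasiMeasurePreserving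
      ((Measure.quasiMeasurePreserving_eval (fun _ : Fin n => (volume : Measure (E d))) i).comp
        Measure.quasiMeasurePreserving_fst)
  have h2 : ∀ j, AEMeasurable (fun z : (Fin n → E d) × E d => φ j z.2) volume := fun j =>
    (hφ j).1.aemeasurable.comp_quasiMeasurePreserving Measure.quasiMeasurePreserving_snd
  exact Finset.aemeasurable_fun_sum Finset.univ fun j _ =>
    ((Finset.aemeasurable_fun_sum Finset.univ fun i _ => h1 j i).const_mul _).mul (h2 j)

theorem risk_linearAggregate_le (hL : 0 ≤ L) (hn : 1 ≤ n) (hp : p ∈ boundedDensities d L)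
    {M M' : ℕ} {f : Fin M → E d → ℝ} (hf : ∀ j, MemLp (f j) 2 volume) {φ : Fin M' → E d → ℝ}
    (h : IsOrthonormalBasisOfSpan f hf φ) :
    risk (linearAggregate φ n) p ≤ oracleRisk f univ p + ENNReal.ofReal (M' * (L / n)) := by
  obtain ⟨hφ, ho, hspan⟩ := h
  have hp2 := memLp_two_of_mem_boundedDensities hL hp
  have := isProbabilityMeasure_densityLaw hp
  have : IsProbabilityMeasure (sampleLaw n p) := by unfold sampleLaw; infer_instance
  set e := fun j => (hφ j).toLp (φ j) with he
  set F := hp2.toLp p with hF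
  -- The squared distance from `p` to the span.
  set A := ENNReal.ofReal (‖∑ j, inner ℝ (e j) F • e j - F‖ ^ 2) with hA
  have hin : ∀ j, inner ℝ (e j) F = ∫ x, φ j x ∂(densityLaw p) := fun j =>
    inner_toLp_eq_integral_densityLaw hp hp2 (hφ j)
  have hpt : ∀ w : Fin M' → ℝ, sqNorm (fun x => linComb φ w x - p x) =
      ∑ j, ENNReal.ofReal ((w j - ∫ x, φ j x ∂(densityLaw p)) ^ 2) + A := by
    intro w
    rw [sqNorm_linComb_sub hφ w hp2, norm_sum_smul_sub_sq ho,
      ENNReal.ofReal_add (Finset.sum_nonneg fun j _ => sq_nonneg _) (sq_nonneg _),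
      ENNReal.ofReal_sum_of_nonneg fun j _ => sq_nonneg _]
    simp only [← hF, hin, hA]
  have hrisk : risk (linearAggregate φ n) p ≤ ENNReal.ofReal (M' * (L / n)) + A := by
    have h1 : ∀ X : Fin n → E d, sqNorm (fun x => linearAggregate φ n X x - p x) =
        ∑ j, ENNReal.ofReal ((empMean (φ j) n X - ∫ x, φ j x ∂(densityLaw p)) ^ 2) + A :=
      fun X => hpt fun j => empMean (φ j) n X
    unfold risk
    simp only [h1]
    rw [lintegral_add_right _ measurable_const, lintegral_const, measure_univ, mul_one]
    gcongr
    have hmeas : ∀ j, AEMeasurable (fun X : Fin n → E d =>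
        ENNReal.ofReal ((empMean (φ j) n X - ∫ x, φ j x ∂(densityLaw p)) ^ 2))
        (sampleLaw n p) := by
      intro j
      have hev : ∀ i : Fin n, AEMeasurable (fun X : Fin n → E d => φ j (X i)) (sampleLaw n p) :=
        fun i => (memLp_densityLaw hL hp (hφ j)).1.aemeasurable.comp_quasiMeasurePreserving
          (measurePreserving_eval (fun _ : Fin n => densityLaw p) i).quasiMeasurePreserving
      exact ((((Finset.aemeasurable_fun_sum Finset.univ fun i _ => hev i).const_mul
        _).sub_const _).pow_const 2).ennreal_ofReal
    rw [lintegral_finsetSum' _ fun j _ => hmeas j]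
    calc _ ≤ ∑ _j : Fin M', ENNReal.ofReal (L / n) :=
          Finset.sum_le_sum fun j _ =>
            lintegral_empMean_sub_sq_le hL hn hp (hφ j) (ho.1 j)
      _ = ENNReal.ofReal (M' * (L / n)) := by
          rw [ENNReal.ofReal_mul (Nat.cast_nonneg _)]; simp
  -- Any combination of the `f j` is one of the `φ j`, and Pythagoras then bounds its error below by
  -- `A`.
  have hora : A ≤ oracleRisk f univ p := by
    refine le_iInf₂ fun w _ => ?_
    rw [sqNorm_linComb_sub hf w hp2]
    have hmem : ∑ j, w j • (hf j).toLp (f j) ∈ Submodule.span ℝ (range e) := by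
      rw [hspan]
      exact Submodule.sum_mem _ fun j _ =>
        Submodule.smul_mem _ _ (Submodule.subset_span (mem_range_self j))
    obtain ⟨u, hu⟩ := (Submodule.mem_span_range_iff_exists_fun ℝ).1 hmem
    rw [← hu, norm_sum_smul_sub_sq ho]
    exact ENNReal.ofReal_le_ofReal (le_add_of_nonneg_left (Finset.sum_nonneg fun j _ => sq_nonneg _))
  calc _ ≤ _ := hrisk
    _ ≤ _ := by rw [add_comm]; gcongr

theorem card_le_of_isOrthonormalBasisOfSpan {M M' : ℕ} {f : Fin M → E d → ℝ}
    {hf : ∀ j, MemLp (f j) 2 volume} {φ : Fin M' → E d → ℝ}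
    (h : IsOrthonormalBasisOfSpan f hf φ) : M' ≤ M := by
  obtain ⟨hφ, ho, hspan⟩ := h
  have h1 := finrank_span_eq_card ho.linearIndependent
  have h2 := finrank_range_le_card (R := ℝ) fun j => (hf j).toLp (f j)
  rw [Set.finrank, ← hspan, h1] at h2
  simpa using h2

theorem attainsRate_linearAggregate (hL : 0 ≤ L) {M M' : ℕ} {f : Fin M → E d → ℝ}
    (hf : ∀ j, MemLp (f j) 2 volume) {φ : Fin M' → E d → ℝ}
    (h : IsOrthonormalBasisOfSpan f hf φ) :
    AttainsRate (boundedDensities d L) univ (fun n M => L * M / n) 1 f (linearAggregate φ) := by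
  refine fun n hn => ⟨isEstimator_linearAggregate h.1 n, iSup₂_le fun p hp => ?_⟩
  have hM : (M' : ℝ) ≤ M := by exact_mod_cast card_le_of_isOrthonormalBasisOfSpan h
  have h1 := risk_linearAggregate_le hL hn hp hf h
  have h2 : (M' : ℝ) * (L / n) ≤ 1 * (L * M / n) := by
    calc (M' : ℝ) * (L / n) ≤ M * (L / n) := by gcongr
      _ = 1 * (L * M / n) := by ring
  have h3 : risk (linearAggregate φ n) p ≤
      ENNReal.ofReal (1 * (L * M / n)) + oracleRisk f univ p := by
    rw [add_comm]
    exact h1.trans (by gcongr)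
  have h4 : (0 : ℝ) ≤ 1 * (L * M / n) := by positivity
  -- Finiteness of the rate settles both side conditions, whatever the oracle risk.
  rw [EReal.sub_le_iff_le_add (Or.inr (EReal.coe_ne_top _)) (Or.inr (EReal.coe_ne_bot _))]
  calc ((risk (linearAggregate φ n) p : ℝ≥0∞) : EReal)
      ≤ ((ENNReal.ofReal (1 * (L * M / n)) + oracleRisk f univ p : ℝ≥0∞) : EReal) := by
        exact_mod_cast h3
    _ = _ := by rw [EReal.coe_ennreal_add, EReal.coe_ennreal_ofReal, max_eq_left h4]

theorem exists_isOrthonormalBasisOfSpan {M : ℕ} (f : Fin M → E d → ℝ)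
    (hf : ∀ j, MemLp (f j) 2 volume) :
    ∃ (M' : ℕ) (φ : Fin M' → E d → ℝ), IsOrthonormalBasisOfSpan f hf φ := by
  set S := Submodule.span ℝ (range fun j => (hf j).toLp (f j)) with hS
  have : FiniteDimensional ℝ S := FiniteDimensional.span_of_finite ℝ (finite_range _)
  let b := stdOrthonormalBasis ℝ S
  refine ⟨Module.finrank ℝ S, fun j => ((b j : S) : Lp ℝ 2 (volume : Measure (E d))),
    fun j => Lp.memLp _, ?_, ?_⟩
  · simp only [Lp.toLp_coeFn]
    exact b.orthonormal.comp_linearIsometry S.subtypeₗᵢ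
  · simp only [Lp.toLp_coeFn]
    rw [← hS]
    have h1 : (range fun j => ((b j : S) : Lp ℝ 2 (volume : Measure (E d)))) =
        S.subtype '' range b := by
      rw [← range_comp]; rfl
    rw [h1, Submodule.span_image, ← b.coe_toBasis, b.toBasis.span_eq, Submodule.map_top,
      Submodule.range_subtype]

end linearAggregate

/-! ### Product measures with densities -/

theorem lintegral_fin_prod {α : Type*} [MeasurableSpace α] (μ : Measure α) [SigmaFinite μ]
    {n : ℕ} {f : Fin n → α → ℝ≥0∞} (hf : ∀ i, Measurable (f i)) :
    ∫⁻ x, ∏ i, f i (x i) ∂(Measure.pi fun _ : Fin n => μ) = ∏ i, ∫⁻ x, f i x ∂μ := by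
  induction n with
  | zero => simp
  | succ n ih =>
    have hF : Measurable fun x : Fin (n + 1) → α => ∏ i, f i (x i) :=
      Finset.measurable_fun_prod _ fun i _ => (hf i).comp (measurable_pi_apply i)
    have hG : Measurable fun y : Fin n → α => ∏ i : Fin n, f i.succ (y i) :=
      Finset.measurable_fun_prod _ fun i _ => (hf i.succ).comp (measurable_pi_apply i)
    rw [← ((measurePreserving_piFinSuccAbove (fun _ : Fin (n + 1) => μ) 0).symm).lintegral_comp hF,
      Fin.prod_univ_succ, ← ih fun i => hf i.succ,
      ← lintegral_prod_mul (hf 0).aemeasurable hG.aemeasurable]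
    refine lintegral_congr fun z => ?_
    simp [MeasurableEquiv.piFinSuccAbove_symm_apply, Fin.insertNthEquiv, Fin.prod_univ_succ]

/-- Expresses all sample laws as densities against one measure, as the two-point bound requires. -/
theorem pi_withDensity {α : Type*} [MeasurableSpace α] (μ : Measure α) [SigmaFinite μ] (n : ℕ)
    {f : α → ℝ≥0∞} (hf : Measurable f) [SigmaFinite (μ.withDensity f)] :
    Measure.pi (fun _ : Fin n => μ.withDensity f) =
      (Measure.pi fun _ : Fin n => μ).withDensity fun x => ∏ i, f (x i) := by
  refine Measure.pi_eq fun s hs => ?_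
  rw [withDensity_apply _ (MeasurableSet.univ_pi hs), ← lintegral_indicator (.univ_pi hs)]
  have h : ∀ x : Fin n → α, (univ.pi s).indicator (fun x => ∏ i, f (x i)) x =
      ∏ i, (s i).indicator f (x i) := by
    intro x
    by_cases hx : x ∈ univ.pi s
    · rw [indicator_of_mem hx]
      exact Finset.prod_congr rfl fun i _ => (indicator_of_mem (hx i (mem_univ i)) f).symm
    · rw [indicator_of_notMem hx]
      simp only [mem_pi, mem_univ, true_implies, not_forall] at hx
      obtain ⟨i, hi⟩ := hx
      exact (Finset.prod_eq_zero (Finset.mem_univ i) (indicator_of_notMem hi f)).symm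
  simp only [h]
  rw [lintegral_fin_prod μ fun i => hf.indicator (hs i)]
  exact Finset.prod_congr rfl fun i _ => by
    rw [lintegral_indicator (hs i), withDensity_apply _ (hs i)]

/-! ### Assouad's lemma -/

/-- For `f ≤ g` the claim reduces to `16fg ≤ (5f + g)²`, whose difference is `(3f - g)² + 16f²`.
Integrated against two probability densities, it turns affinity `3/4` into overlap `∫ min f g ≥
1/4`, with no Cauchy–Schwarz inequality. -/
theorem le_min_add_of_sq_le_mul {f g G : ℝ≥0∞} (h : G ^ 2 ≤ f * g) :
    G ≤ min f g + (f + g) / 4 := by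
  have key : ∀ {f g : ℝ≥0∞}, f ≤ g → G ^ 2 ≤ f * g → G ≤ f + (f + g) / 4 := by
    intro f g hfg h
    rcases eq_or_ne g ∞ with rfl | hg
    · simp [ENNReal.top_div]
    have hf := ne_top_of_le_ne_top hg hfg
    have hG : G ≠ ∞ := by
      rintro rfl
      exact (ENNReal.mul_lt_top hf.lt_top hg.lt_top).not_ge (by simpa using h)
    have h' : G.toReal ^ 2 ≤ f.toReal * g.toReal := by
      rw [← ENNReal.toReal_pow, ← ENNReal.toReal_mul]
      exact ENNReal.toReal_mono (ENNReal.mul_ne_top hf hg) h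
    have hR : f + (f + g) / 4 ≠ ∞ :=
      ENNReal.add_ne_top.2 ⟨hf, ENNReal.div_ne_top (ENNReal.add_ne_top.2 ⟨hf, hg⟩) (by simp)⟩
    rw [← ENNReal.toReal_le_toReal hG hR, ENNReal.toReal_add hf (ENNReal.add_ne_top.1 hR).2,
      ENNReal.toReal_div, ENNReal.toReal_add hf hg]
    have h1 : 0 ≤ f.toReal := ENNReal.toReal_nonneg
    have h2 : 0 ≤ g.toReal := ENNReal.toReal_nonneg
    refine abs_le_of_sq_le_sq' ?_ (by positivity) |>.2
    simp only [ENNReal.toReal_ofNat]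
    nlinarith [sq_nonneg (f.toReal - g.toReal), sq_nonneg (3 * f.toReal - g.toReal)]
  rcases le_total f g with hfg | hfg
  · rw [min_eq_left hfg]; exact key hfg h
  · rw [min_eq_right hfg, add_comm f g]; exact key hfg (by rwa [mul_comm])

/-- Le Cam's two-point bound, for two laws with densities `f` and `g` whose Hellinger affinity is
at least `3/4`. -/
theorem two_point_bound {Ω : Type*} [MeasurableSpace Ω] {μ : Measure Ω} {f g G a b : Ω → ℝ≥0∞}
    (hf : Measurable f) (hg : Measurable g) (ha : Measurable a) (hb : Measurable b)
    (hf1 : ∫⁻ ω, f ω ∂μ = 1) (hg1 : ∫⁻ ω, g ω ∂μ = 1) (hG : ∀ ω, G ω ^ 2 ≤ f ω * g ω)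
    (hG1 : 3 / 4 ≤ ∫⁻ ω, G ω ∂μ) {δ : ℝ≥0∞} (hδ : ∀ ω, δ ≤ a ω + b ω) :
    δ / 4 ≤ ∫⁻ ω, a ω ∂(μ.withDensity f) + ∫⁻ ω, b ω ∂(μ.withDensity g) := by
  have hmin : 1 / 4 ≤ ∫⁻ ω, min (f ω) (g ω) ∂μ := by
    have h1 : ∫⁻ ω, G ω ∂μ ≤ ∫⁻ ω, min (f ω) (g ω) ∂μ + 1 / 2 := by
      calc ∫⁻ ω, G ω ∂μ ≤ ∫⁻ ω, (min (f ω) (g ω) + (f ω + g ω) / 4) ∂μ :=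
            lintegral_mono fun ω => le_min_add_of_sq_le_mul (hG ω)
        _ = ∫⁻ ω, min (f ω) (g ω) ∂μ + (1 + 1) / 4 := by
            rw [lintegral_add_left (hf.min hg)]
            simp only [div_eq_mul_inv]
            rw [lintegral_mul_const (f := fun ω => f ω + g ω) _ (hf.add hg), lintegral_add_left hf, hf1, hg1]
        _ = _ := by
            congr 1
            rw [← ENNReal.toReal_eq_toReal_iff' (by finiteness) (by finiteness)]
            norm_num
    have h2 : (1 / 4 : ℝ≥0∞) + 1 / 2 = 3 / 4 := by
      rw [← ENNReal.toReal_eq_toReal_iff' (by finiteness) (by finiteness),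
        ENNReal.toReal_add (by finiteness) (by finiteness)]
      norm_num
    have h3 := hG1.trans h1
    rw [← h2] at h3
    exact (ENNReal.add_le_add_iff_right (by finiteness)).1 h3
  rw [lintegral_withDensity_eq_lintegral_mul _ hf ha, lintegral_withDensity_eq_lintegral_mul _ hg hb,
    ← lintegral_add_left (hf.mul ha)]
  calc δ / 4 = δ * (1 / 4) := by rw [one_div, div_eq_mul_inv]
    _ ≤ δ * ∫⁻ ω, min (f ω) (g ω) ∂μ := by gcongr
    _ = ∫⁻ ω, δ * min (f ω) (g ω) ∂μ := (lintegral_const_mul _ (hf.min hg)).symm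
    _ ≤ _ := lintegral_mono fun ω => by
        calc δ * min (f ω) (g ω) ≤ (a ω + b ω) * min (f ω) (g ω) := by gcongr; exact hδ ω
          _ = min (f ω) (g ω) * a ω + min (f ω) (g ω) * b ω := by ring
          _ ≤ f ω * a ω + g ω * b ω := by
              gcongr
              · exact min_le_left _ _
              · exact min_le_right _ _

/-- The combinatorial part of Assouad's lemma. -/
theorem exists_le_of_flip {m : ℕ} {R : (Fin m → Bool) → ℝ≥0∞}
    {X : (Fin m → Bool) → Fin m → ℝ≥0∞} {D : ℝ≥0∞} (hR : ∀ σ, ∑ j, X σ j ≤ R σ)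
    (hX : ∀ σ j, D ≤ X σ j + X (Function.update σ j (!σ j)) j) :
    ∃ σ, m * (D / 2) ≤ R σ := by
  -- Flipping coordinate `j` permutes the vertices, so `hX` summed over `σ` counts each `X σ j`
  -- twice.
  have h1 : ∀ j, ∑ _σ : Fin m → Bool, D / 2 ≤ ∑ σ, X σ j := by
    intro j
    have hinv : Function.Involutive fun σ : Fin m → Bool => Function.update σ j (!σ j) :=
      fun σ => by simp
    have h2 : ∑ σ, X (Function.update σ j (!σ j)) j = ∑ σ, X σ j :=
      Equiv.sum_comp hinv.toPerm fun σ => X σ j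
    have h3 : ∑ _σ : Fin m → Bool, D ≤ 2 * ∑ σ, X σ j := by
      rw [two_mul]
      nth_rw 2 [← h2]
      rw [← Finset.sum_add_distrib]
      exact Finset.sum_le_sum fun σ _ => hX σ j
    have h4 : 2 * ∑ _σ : Fin m → Bool, D / 2 = ∑ _σ : Fin m → Bool, D := by
      rw [Finset.mul_sum]
      simp only [ENNReal.mul_div_cancel two_ne_zero ENNReal.ofNat_ne_top]
    rw [← h4] at h3
    exact (ENNReal.mul_le_mul_iff_right two_ne_zero ENNReal.ofNat_ne_top).1 h3
  by_contra! hlt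
  refine (ENNReal.sum_lt_sum_of_nonempty Finset.univ_nonempty fun σ _ => hlt σ).not_ge ?_
  calc ∑ _σ : Fin m → Bool, (m : ℝ≥0∞) * (D / 2)
      = ∑ _j : Fin m, ∑ _σ : Fin m → Bool, D / 2 := by
        rw [Finset.sum_const, Finset.sum_const, Finset.sum_const]
        simp only [Finset.card_univ, Fintype.card_fin, nsmul_eq_mul]
        ring
    _ ≤ ∑ j, ∑ σ, X σ j := Finset.sum_le_sum fun j _ => h1 j
    _ = ∑ σ, ∑ j, X σ j := Finset.sum_comm
    _ ≤ ∑ σ, R σ := Finset.sum_le_sum fun σ _ => hR σ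

/-! ### Step functions -/

/-- There are disjoint boxes of any given volume. -/
theorem exists_disjoint_boxes (hd : 1 ≤ d) (ι : Type*) [Fintype ι] {v : ℝ} (hv : 0 < v) :
    ∃ B : ι → Set (E d), (∀ i, MeasurableSet (B i)) ∧ Pairwise (Function.onFun Disjoint B) ∧
      ∀ i, volume (B i) = ENNReal.ofReal v := by
  classical
  let k₀ : Fin d := ⟨0, hd⟩
  let N := fun i : ι => ((Fintype.equivFin ι i : ℕ) : ℝ)
  -- Boxes of length `v` stacked along the first axis, with unit sides in the other directions.
  let b : ι → Fin d → Set ℝ := fun i k => if k = k₀ then Ico (N i * v) ((N i + 1) * v) else Ico 0 1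
  have hb : ∀ i k, MeasurableSet (b i k) := fun i k => by
    simp only [b]; split_ifs <;> exact measurableSet_Ico
  refine ⟨fun i => WithLp.ofLp ⁻¹' univ.pi (b i), fun i => ?_, fun i j hij => ?_, fun i => ?_⟩
  · exact (PiLp.volume_preserving_ofLp (Fin d)).measurable (MeasurableSet.univ_pi (hb i))
  · refine Disjoint.preimage _ (Set.disjoint_left.2 fun x hx hy => hij ?_)
    have h1 := hx k₀ (mem_univ _)
    have h2 := hy k₀ (mem_univ _)
    simp only [b, if_true, mem_Ico] at h1 h2
    have h3 : N i < N j + 1 := lt_of_mul_lt_mul_right (h1.1.trans_lt h2.2) hv.le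
    have h4 : N j < N i + 1 := lt_of_mul_lt_mul_right (h2.1.trans_lt h1.2) hv.le
    have h5 : (Fintype.equivFin ι i : ℕ) < (Fintype.equivFin ι j : ℕ) + 1 := by
      simp only [N] at h3; exact_mod_cast h3
    have h6 : (Fintype.equivFin ι j : ℕ) < (Fintype.equivFin ι i : ℕ) + 1 := by
      simp only [N] at h4; exact_mod_cast h4
    exact (Fintype.equivFin ι).injective (Fin.ext (by omega))
  · rw [(PiLp.volume_preserving_ofLp (Fin d)).measure_preimage
      (MeasurableSet.univ_pi (hb i)).nullMeasurableSet, volume_pi_pi]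
    have : ∀ k, volume (b i k) = if k = k₀ then ENNReal.ofReal v else 1 := by
      intro k
      simp only [b]
      split_ifs
      · rw [Real.volume_Ico]; congr 1; ring
      · simp
    simp [this]

section step

variable {ι : Type*} [Fintype ι] {B : ι → Set (E d)} {v : ℝ}

/-- The step function with value `a i` on `B i`. -/
def step (B : ι → Set (E d)) (a : ι → ℝ) (x : E d) : ℝ := ∑ i, (B i).indicator (fun _ => a i) x

theorem step_of_mem (hd : Pairwise (Function.onFun Disjoint B)) (a : ι → ℝ) {i : ι} {x : E d}
    (hx : x ∈ B i) : step B a x = a i := by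
  unfold step
  rw [Finset.sum_eq_single i, indicator_of_mem hx]
  · intro j _ hj
    exact indicator_of_notMem (fun h => Set.disjoint_left.1 (hd hj) h hx) _
  · simp

theorem step_of_notMem (a : ι → ℝ) {x : E d} (hx : ∀ i, x ∉ B i) : step B a x = 0 :=
  Finset.sum_eq_zero fun i _ => indicator_of_notMem (hx i) _

theorem measurable_step (hB : ∀ i, MeasurableSet (B i)) (a : ι → ℝ) : Measurable (step B a) :=
  Finset.measurable_fun_sum _ fun i _ => measurable_const.indicator (hB i)

theorem memLp_step (hB : ∀ i, MeasurableSet (B i)) (hv : ∀ i, volume (B i) = ENNReal.ofReal v)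
    (q : ℝ≥0∞) (a : ι → ℝ) : MemLp (step B a) q volume :=
  memLp_finsetSum Finset.univ fun i _ =>
    memLp_indicator_const q (hB i) (a i) (Or.inr (by rw [hv]; exact ENNReal.ofReal_ne_top))

theorem integral_step (hB : ∀ i, MeasurableSet (B i)) (hv0 : 0 ≤ v)
    (hv : ∀ i, volume (B i) = ENNReal.ofReal v) (a : ι → ℝ) :
    ∫ x, step B a x = v * ∑ i, a i := by
  unfold step
  rw [integral_finsetSum _ fun i _ => (memLp_one_iff_integrable.1
    (memLp_indicator_const 1 (hB i) (a i) (Or.inr (by rw [hv]; exact ENNReal.ofReal_ne_top))))]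
  simp [integral_indicator_const _ (hB _), measureReal_def, hv, hv0, Finset.mul_sum]

theorem step_nonneg {a : ι → ℝ} (ha : ∀ i, 0 ≤ a i) (x : E d) : 0 ≤ step B a x :=
  Finset.sum_nonneg fun i _ => indicator_nonneg (fun _ _ => ha i) x

theorem lintegral_step (hB : ∀ i, MeasurableSet (B i)) (hv0 : 0 ≤ v)
    (hv : ∀ i, volume (B i) = ENNReal.ofReal v) {a : ι → ℝ} (ha : ∀ i, 0 ≤ a i) :
    ∫⁻ x, ENNReal.ofReal (step B a x) = ENNReal.ofReal (v * ∑ i, a i) := by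
  rw [← integral_step hB hv0 hv, ofReal_integral_eq_lintegral_ofReal
    (memLp_one_iff_integrable.1 (memLp_step hB hv 1 a)) (ae_of_all _ (step_nonneg ha))]

theorem step_mem_boundedDensities (hB : ∀ i, MeasurableSet (B i))
    (hd : Pairwise (Function.onFun Disjoint B)) (hv0 : 0 ≤ v)
    (hv : ∀ i, volume (B i) = ENNReal.ofReal v) {a : ι → ℝ} (ha : ∀ i, 0 ≤ a i)
    {L : ℝ} (hL : 0 ≤ L) (haL : ∀ i, a i ≤ L) (h1 : v * ∑ i, a i = 1) :
    step B a ∈ boundedDensities d L := by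
  refine ⟨step_nonneg ha, memLp_one_iff_integrable.1 (memLp_step hB hv 1 a), ?_, ?_⟩
  · rw [integral_step hB hv0 hv, h1]
  · rw [eLpNorm_exponent_top]
    refine eLpNormEssSup_le_of_ae_bound (ae_of_all _ fun x => ?_)
    rw [Real.norm_of_nonneg (step_nonneg ha x)]
    by_cases hx : ∃ i, x ∈ B i
    · obtain ⟨i, hi⟩ := hx
      rw [step_of_mem hd a hi]
      exact haL i
    · rw [step_of_notMem a (not_exists.1 hx)]
      exact hL

/-- Discarding the loss outside the boxes makes the rest additive over boxes, as Assouad's lemma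
needs. -/
theorem sum_setLIntegral_le_sqNorm_sub_step (hB : ∀ i, MeasurableSet (B i))
    (hd : Pairwise (Function.onFun Disjoint B)) (a : ι → ℝ) (g : E d → ℝ) :
    ∑ i, ∫⁻ x in B i, ‖g x - a i‖ₑ ^ 2 ≤ sqNorm fun x => g x - step B a x := by
  calc ∑ i, ∫⁻ x in B i, ‖g x - a i‖ₑ ^ 2
      = ∑ i, ∫⁻ x in B i, ‖g x - step B a x‖ₑ ^ 2 :=
        Finset.sum_congr rfl fun i _ => setLIntegral_congr_fun (hB i) fun x hx => by
          simp only [step_of_mem hd a hx]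
    _ = ∫⁻ x in ⋃ i, B i, ‖g x - step B a x‖ₑ ^ 2 := by
        rw [lintegral_iUnion hB hd, tsum_fintype]
    _ ≤ _ := setLIntegral_le_lintegral _ _

/-- The total mass is left free: it is one for vertex densities and smaller for the affinity
minorant. -/
theorem lintegral_prod_step (hB : ∀ i, MeasurableSet (B i)) (hv0 : 0 ≤ v)
    (hv : ∀ i, volume (B i) = ENNReal.ofReal v) {a : ι → ℝ} (ha : ∀ i, 0 ≤ a i) (n : ℕ) :
    ∫⁻ X : Fin n → E d, ∏ i, ENNReal.ofReal (step B a (X i)) =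
      ENNReal.ofReal (v * ∑ i, a i) ^ n := by
  rw [volume_pi, lintegral_fin_prod _ fun _ => (measurable_step hB a).ennreal_ofReal]
  simp [lintegral_step hB hv0 hv ha]

end step

/-! ### Modification of estimators -/

/-- `IsEstimator` gives only a.e. measurability, while the two-point bound needs losses measurable
in the sample. By Fubini the modification changes `T X` only on a null set for almost every `X`,
which no risk under an absolutely continuous law detects. -/
theorem exists_measurable_risk_eq {n : ℕ} {T : (Fin n → E d) → E d → ℝ} (hT : IsEstimator T) :
    ∃ T' : (Fin n → E d) → E d → ℝ, Measurable (Function.uncurry T') ∧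
      ∀ p : E d → ℝ, sampleLaw n p ≪ volume → risk T p = risk T' p := by
  refine ⟨Function.curry (hT.mk _), by simpa using hT.measurable_mk, fun p hp => ?_⟩
  have h := Measure.ae_ae_of_ae_prod hT.ae_eq_mk
  refine lintegral_congr_ae ?_
  filter_upwards [hp.ae_le h] with X hX
  refine sqNorm_congr_ae ?_
  filter_upwards [hX] with x hx
  simp only [Function.uncurry] at hx
  simp [hx, Function.curry]

theorem le_maxExcessRisk {M n : ℕ} {P : Set (E d → ℝ)} {H : Set (Fin M → ℝ)}
    {f : Fin M → E d → ℝ} {T : (Fin n → E d) → E d → ℝ} {p : E d → ℝ} (hp : p ∈ P)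
    (h0 : oracleRisk f H p = 0) {r : ℝ} (hr : 0 ≤ r) (h : ENNReal.ofReal r ≤ risk T p) :
    (r : EReal) ≤ maxExcessRisk P H f T := by
  refine le_trans ?_ (le_iSup₂ (f := fun p (_ : p ∈ P) =>
    ((risk T p : ℝ≥0∞) : EReal) - ((oracleRisk f H p : ℝ≥0∞) : EReal)) p hp)
  rw [h0, EReal.coe_ennreal_zero, sub_zero]
  calc (r : EReal) = ((ENNReal.ofReal r : ℝ≥0∞) : EReal) := by
        rw [EReal.coe_ennreal_ofReal, max_eq_left hr]
    _ ≤ _ := by exact_mod_cast h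

/-! ### The lower bound -/

section hypercube

variable {m : ℕ} {L ε : ℝ}

/-- The sign `±1` encoded by a Boolean. -/
def sgn (b : Bool) : ℝ := cond b 1 (-1)

/-- The values, indexed by pairs `(j, s)`, of the density at the vertex `σ` of the hypercube. -/
def vertexValue (L ε : ℝ) (σ : Fin m → Bool) (i : Fin m × Bool) : ℝ :=
  L / 2 * (1 + ε * (sgn (σ i.1) * sgn i.2))

/-- The functions spanning the hypercube: the indicator of the union of all the sets
`B (j, s)`, and the differences of the indicators of `B (j, true)` and `B (j, false)`. -/
def hypercubeSpan (B : Fin m × Bool → Set (E d)) : Fin (m + 1) → E d → ℝ :=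
  Fin.cons (step B fun _ => 1) fun j => step B fun i => if i.1 = j then sgn i.2 else 0

theorem vertexValue_bounds (hL : 0 ≤ L) (hε0 : 0 ≤ ε) (hε1 : ε ≤ 1) (σ : Fin m → Bool)
    (i : Fin m × Bool) : 0 ≤ vertexValue L ε σ i ∧ vertexValue L ε σ i ≤ L := by
  have h : sgn (σ i.1) * sgn i.2 = 1 ∨ sgn (σ i.1) * sgn i.2 = -1 := by
    cases σ i.1 <;> cases i.2 <;> simp [sgn]
  unfold vertexValue
  rcases h with h | h <;> rw [h] <;> constructor <;> nlinarith

/-- The signs cancel within each pair, so every vertex has the same mass. -/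
theorem sum_vertexValue (σ : Fin m → Bool) : ∑ i, vertexValue L ε σ i = m * L := by
  have : ∀ j : Fin m, ∑ s, vertexValue L ε σ (j, s) = L := fun j => by
    simp only [Fintype.sum_bool, vertexValue, sgn, cond_true, cond_false]
    ring
  rw [Fintype.sum_prod_type, Finset.sum_congr rfl fun j _ => this j]
  simp

theorem memLp_hypercubeSpan {B : Fin m × Bool → Set (E d)} {v : ℝ}
    (hB : ∀ i, MeasurableSet (B i)) (hv : ∀ i, volume (B i) = ENNReal.ofReal v)
    (j : Fin (m + 1)) : MemLp (hypercubeSpan B j) 2 volume := by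
  refine Fin.cases ?_ (fun k => ?_) j
  · simpa [hypercubeSpan] using memLp_step hB hv 2 _
  · simpa [hypercubeSpan] using memLp_step hB hv 2 _

theorem oracleRisk_hypercubeSpan {B : Fin m × Bool → Set (E d)}
    (hd : Pairwise (Function.onFun Disjoint B)) (σ : Fin m → Bool) :
    oracleRisk (hypercubeSpan B) univ (step B (vertexValue L ε σ)) = 0 := by
  -- The vertex values are affine in the signs: a constant plus one term per pair.
  let w : Fin (m + 1) → ℝ := Fin.cons (L / 2) fun j => L / 2 * (ε * sgn (σ j))
  have h : ∀ x, linComb (hypercubeSpan B) w x = step B (vertexValue L ε σ) x := by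
    intro x
    simp only [linComb, Fin.sum_univ_succ, hypercubeSpan, w, Fin.cons_zero, Fin.cons_succ]
    by_cases hx : ∃ i, x ∈ B i
    · obtain ⟨i, hi⟩ := hx
      simp only [step_of_mem hd _ hi, vertexValue, mul_ite, mul_zero, Finset.sum_ite_eq,
        Finset.mem_univ, if_true]
      ring
    · simp [step_of_notMem _ (not_exists.1 hx)]
  refine le_antisymm ((iInf₂_le w (mem_univ _)).trans ?_) zero_le
  simp [sqNorm, h]

/-- The values of a step function which is at most the geometric mean of the densities at two
vertices that differ in the coordinate `j` only. -/
def affinityValue (L ε : ℝ) (σ : Fin m → Bool) (j : Fin m) (i : Fin m × Bool) : ℝ :=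
  if i.1 = j then L / 2 * (1 - ε ^ 2) else vertexValue L ε σ i

theorem affinityValue_nonneg (hL : 0 ≤ L) (hε0 : 0 ≤ ε) (hε1 : ε ≤ 1) (σ : Fin m → Bool)
    (j : Fin m) (i : Fin m × Bool) : 0 ≤ affinityValue L ε σ j i := by
  unfold affinityValue
  split_ifs
  · exact mul_nonneg (by positivity) (by nlinarith)
  · exact (vertexValue_bounds hL hε0 hε1 σ i).1

/-- On the flipped pair the geometric mean is `(L/2)√(1 - ε²)`, and `1 - ε² ≤ √(1 - ε²)` avoids the
root; elsewhere the two densities agree. -/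
theorem affinityValue_sq_le (hε0 : 0 ≤ ε) (hε1 : ε ≤ 1) (σ : Fin m → Bool)
    (j : Fin m) (i : Fin m × Bool) : affinityValue L ε σ j i ^ 2 ≤
      vertexValue L ε σ i * vertexValue L ε (Function.update σ j (!σ j)) i := by
  unfold affinityValue
  split_ifs with h
  · have h1 : vertexValue L ε σ i * vertexValue L ε (Function.update σ j (!σ j)) i =
        (L / 2) ^ 2 * (1 - ε ^ 2) := by
      subst h
      unfold vertexValue
      rw [Function.update_self]
      cases σ i.1 <;> cases i.2 <;> simp [sgn] <;> ring
    rw [h1, mul_pow]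
    have h2 : 0 ≤ ε ^ 2 := sq_nonneg _
    have h3 : ε ^ 2 ≤ 1 := by nlinarith
    exact mul_le_mul_of_nonneg_left (by nlinarith) (sq_nonneg _)
  · have h1 : vertexValue L ε (Function.update σ j (!σ j)) i = vertexValue L ε σ i := by
      unfold vertexValue
      rw [Function.update_of_ne h]
    rw [h1, sq]

theorem sum_affinityValue (σ : Fin m → Bool) (j : Fin m) :
    ∑ i, affinityValue L ε σ j i = m * L - L * ε ^ 2 := by
  have h1 : ∀ k : Fin m, ∑ s, affinityValue L ε σ j (k, s) =
      L - if k = j then L * ε ^ 2 else 0 := fun k => by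
    by_cases h : k = j
    · simp only [affinityValue, h, if_true, Fintype.sum_bool]
      ring
    · simp only [affinityValue, h, if_false, Fintype.sum_bool, vertexValue, sgn, cond_true,
        cond_false]
      ring
  rw [Fintype.sum_prod_type, Finset.sum_congr rfl fun k _ => h1 k]
  simp

/-- The contribution to the loss of the pair of sets with index `j`, if the `j`-th coordinate of
the vertex is `τ`. -/
def localLoss (B : Fin m × Bool → Set (E d)) (L ε : ℝ) (j : Fin m) (τ : Bool) (g : E d → ℝ) :
    ℝ≥0∞ :=
  ∑ s, ∫⁻ x in B (j, s), ‖g x - L / 2 * (1 + ε * (sgn τ * sgn s))‖ₑ ^ 2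

theorem sum_localLoss_le {B : Fin m × Bool → Set (E d)} (hB : ∀ i, MeasurableSet (B i))
    (hd : Pairwise (Function.onFun Disjoint B)) (σ : Fin m → Bool) (g : E d → ℝ) :
    ∑ j, localLoss B L ε j (σ j) g ≤ sqNorm fun x => g x - step B (vertexValue L ε σ) x := by
  refine le_trans (le_of_eq ?_) (sum_setLIntegral_le_sqNorm_sub_step hB hd _ g)
  rw [Fintype.sum_prod_type]
  rfl

/-- The right side is smallest at the midpoint `t = (α + β)/2`. -/
theorem ofReal_sub_sq_le_enorm_sq_add (t α β : ℝ) :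
    ENNReal.ofReal ((α - β) ^ 2 / 2) ≤ ‖t - α‖ₑ ^ 2 + ‖t - β‖ₑ ^ 2 := by
  have h : ∀ s : ℝ, ‖s‖ₑ ^ 2 = ENNReal.ofReal (s ^ 2) := fun s => by
    rw [Real.enorm_eq_ofReal_abs, ← ENNReal.ofReal_pow (abs_nonneg s), sq_abs]
  rw [h, h, ← ENNReal.ofReal_add (sq_nonneg _) (sq_nonneg _)]
  exact ENNReal.ofReal_le_ofReal (by nlinarith [sq_nonneg (2 * t - α - β)])

theorem le_localLoss_add {B : Fin m × Bool → Set (E d)} {v : ℝ} (hv0 : 0 ≤ v)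
    (hv : ∀ i, volume (B i) = ENNReal.ofReal v) (j : Fin m) (τ : Bool) {g : E d → ℝ}
    (hg : Measurable g) :
    ENNReal.ofReal (v * (L * ε) ^ 2) ≤ localLoss B L ε j τ g + localLoss B L ε j (!τ) g := by
  unfold localLoss
  rw [← Finset.sum_add_distrib]
  have h : ∀ s, ENNReal.ofReal (v * (L * ε) ^ 2 / 2) ≤
      (∫⁻ x in B (j, s), ‖g x - L / 2 * (1 + ε * (sgn τ * sgn s))‖ₑ ^ 2) +
        ∫⁻ x in B (j, s), ‖g x - L / 2 * (1 + ε * (sgn (!τ) * sgn s))‖ₑ ^ 2 := by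
    intro s
    rw [← lintegral_add_left ((hg.sub_const _).enorm.pow_const 2)]
    calc ENNReal.ofReal (v * (L * ε) ^ 2 / 2)
        = ∫⁻ _x in B (j, s), ENNReal.ofReal ((L / 2 * (1 + ε * (sgn τ * sgn s)) -
            L / 2 * (1 + ε * (sgn (!τ) * sgn s))) ^ 2 / 2) := by
          rw [setLIntegral_const, hv, ← ENNReal.ofReal_mul (by positivity)]
          congr 1
          cases τ <;> cases s <;> simp [sgn] <;> ring
      _ ≤ _ := lintegral_mono fun x => ofReal_sub_sq_le_enorm_sq_add _ _ _
  calc ENNReal.ofReal (v * (L * ε) ^ 2)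
      = ∑ _s : Bool, ENNReal.ofReal (v * (L * ε) ^ 2 / 2) := by
        rw [Fintype.sum_bool, ← ENNReal.ofReal_add (by positivity) (by positivity), add_halves]
    _ ≤ _ := Finset.sum_le_sum fun s _ => h s

theorem measurable_localLoss (B : Fin m × Bool → Set (E d)) {Ω : Type*} [MeasurableSpace Ω]
    {T : Ω → E d → ℝ} (hT : Measurable (Function.uncurry T)) (j : Fin m) (τ : Bool) :
    Measurable fun ω => localLoss B L ε j τ (T ω) :=
  Finset.measurable_fun_sum _ fun s _ =>
    Measurable.lintegral_prod_right' (ν := volume.restrict (B (j, s)))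
      (f := fun z : Ω × E d => ‖T z.1 z.2 - L / 2 * (1 + ε * (sgn τ * sgn s))‖ₑ ^ 2)
      ((hT.sub_const _).enorm.pow_const 2)

/-- Assouad's bound over the hypercube of densities. -/
theorem exists_vertex_risk_ge {B : Fin m × Bool → Set (E d)} {v : ℝ} (hm : 0 < m)
    (hB : ∀ i, MeasurableSet (B i)) (hd : Pairwise (Function.onFun Disjoint B))
    (hv : ∀ i, volume (B i) = ENNReal.ofReal v) (hL : 0 < L) (hvL : v * (m * L) = 1)
    (hε0 : 0 ≤ ε) (hε1 : ε ≤ 1) {n : ℕ} (hn : n * ε ^ 2 ≤ m / 4)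
    {T : (Fin n → E d) → E d → ℝ} (hT : IsEstimator T) :
    ∃ σ : Fin m → Bool, step B (vertexValue L ε σ) ∈ boundedDensities d L ∧
      ENNReal.ofReal (L * ε ^ 2 / 8) ≤ risk T (step B (vertexValue L ε σ)) := by
  have hm0 : (0 : ℝ) < m := by exact_mod_cast hm
  have hv0 : 0 ≤ v := by
    by_contra! h
    nlinarith [mul_pos hm0 hL]
  have hvm : v * L = 1 / m := by field_simp; linarith
  let p := fun σ : Fin m → Bool => step B (vertexValue L ε σ)
  have hmem : ∀ σ, p σ ∈ boundedDensities d L := fun σ =>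
    step_mem_boundedDensities hB hd hv0 hv (fun i => (vertexValue_bounds hL.le hε0 hε1 σ i).1)
      hL.le (fun i => (vertexValue_bounds hL.le hε0 hε1 σ i).2) (by rw [sum_vertexValue, hvL])
  let F := fun (σ : Fin m → Bool) (X : Fin n → E d) => ∏ i, ENNReal.ofReal (p σ (X i))
  have hF : ∀ σ, Measurable (F σ) := fun σ => Finset.measurable_fun_prod _ fun i _ =>
    ((measurable_step hB _).comp (measurable_pi_apply i)).ennreal_ofReal
  have hF1 : ∀ σ, ∫⁻ X, F σ X = 1 := fun σ => by
    have := lintegral_prod_step hB hv0 hv (fun i => (vertexValue_bounds hL.le hε0 hε1 σ i).1) n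
    rw [sum_vertexValue, hvL] at this
    simpa using this
  have hlaw : ∀ σ, sampleLaw n (p σ) = volume.withDensity (F σ) := fun σ => by
    have := isProbabilityMeasure_densityLaw (hmem σ)
    exact pi_withDensity volume n (measurable_step hB _).ennreal_ofReal
  obtain ⟨T', hT', hrisk⟩ := exists_measurable_risk_eq hT
  let X := fun (σ : Fin m → Bool) (j : Fin m) =>
    ∫⁻ ω, localLoss B L ε j (σ j) (T' ω) ∂(sampleLaw n (p σ))
  have hsum : ∀ σ, ∑ j, X σ j ≤ risk T (p σ) := by
    intro σ
    rw [hrisk (p σ) (by rw [hlaw]; exact withDensity_absolutelyContinuous _ _),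
      ← lintegral_finsetSum _ fun j _ => measurable_localLoss B hT' j (σ j)]
    exact lintegral_mono fun ω => sum_localLoss_le hB hd σ (T' ω)
  have hflip : ∀ σ j, ENNReal.ofReal (v * (L * ε) ^ 2) / 4 ≤
      X σ j + X (Function.update σ j (!σ j)) j := by
    intro σ j
    simp only [X, hlaw, Function.update_self]
    let G := fun X : Fin n → E d => ∏ i, ENNReal.ofReal (step B (affinityValue L ε σ j) (X i))
    refine two_point_bound (G := G) (hF _) (hF _) (measurable_localLoss B hT' _ _)
      (measurable_localLoss B hT' _ _) (hF1 _) (hF1 _) (fun X => ?_) ?_ fun ω =>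
        le_localLoss_add hv0 hv j (σ j) (hT'.comp measurable_prodMk_left)
    · simp only [G, F, ← Finset.prod_pow, ← Finset.prod_mul_distrib]
      refine Finset.prod_le_prod' fun i _ => ?_
      rw [← ENNReal.ofReal_pow (step_nonneg (affinityValue_nonneg hL.le hε0 hε1 σ j) _),
        ← ENNReal.ofReal_mul ((hmem σ).1 _)]
      apply ENNReal.ofReal_le_ofReal
      by_cases hx : ∃ k, X i ∈ B k
      · obtain ⟨k, hk⟩ := hx
        simp only [p, step_of_mem hd _ hk]
        exact affinityValue_sq_le hε0 hε1 σ j k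
      · simp [p, step_of_notMem _ (not_exists.1 hx)]
    · rw [lintegral_prod_step hB hv0 hv (affinityValue_nonneg hL.le hε0 hε1 σ j) n,
        sum_affinityValue]
      have h1 : v * (m * L - L * ε ^ 2) = 1 + -(ε ^ 2 / m) := by
        calc v * (m * L - L * ε ^ 2) = v * (m * L) - v * L * ε ^ 2 := by ring
          _ = _ := by rw [hvL, hvm]; ring
      have hm1 : (1 : ℝ) ≤ m := by exact_mod_cast hm
      have h2 : ε ^ 2 / m ≤ 1 := by
        rw [div_le_one hm0]
        nlinarith
      -- Bernoulli's inequality and `nε² ≤ m/4`.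
      have h3 : (3 / 4 : ℝ) ≤ (1 + -(ε ^ 2 / m)) ^ n := by
        refine le_trans ?_ (one_add_mul_le_pow (by linarith) n)
        have : n * (ε ^ 2 / m) ≤ 1 / 4 := by
          rw [← mul_div_assoc, div_le_iff₀ hm0]
          linarith
        linarith
      rw [h1, ← ENNReal.ofReal_pow (by linarith)]
      calc (3 / 4 : ℝ≥0∞) = ENNReal.ofReal (3 / 4) := by
            rw [ENNReal.ofReal_div_of_pos (by norm_num)]; simp
        _ ≤ _ := ENNReal.ofReal_le_ofReal h3
  obtain ⟨σ, hσ⟩ := exists_le_of_flip hsum hflip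
  refine ⟨σ, hmem σ, le_trans (le_of_eq ?_) hσ⟩
  rw [← ENNReal.ofReal_toReal (a := (m : ℝ≥0∞) * _)
    (ENNReal.mul_ne_top (by simp) (by finiteness))]
  congr 1
  rw [ENNReal.toReal_mul, ENNReal.toReal_div, ENNReal.toReal_div,
    ENNReal.toReal_ofReal (by positivity)]
  simp only [ENNReal.toReal_natCast, ENNReal.toReal_ofNat]
  -- Assouad's bound is `m · (v(Lε)²/4)/2`, and `v · mL = 1`.
  calc L * ε ^ 2 / 8 = v * (m * L) * (L * ε ^ 2 / 8) := by rw [hvL, one_mul]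
    _ = _ := by ring

end hypercube

theorem exists_rateUnimprovable {c₀ : ℝ} (hc₀ : 0 < c₀) (hd : 1 ≤ d) {L : ℝ} (hL : 0 < L) {M : ℕ}
    (hM : 2 ≤ M) : ∃ f : Fin M → E d → ℝ, (∀ j, MemLp (f j) 2 volume) ∧
      RateUnimprovable (boundedDensities d L) univ (fun n M => L * M / n)
        (fun n M => (M : ℝ) ≤ c₀ * n) (min (1 / 8) (1 / c₀) / 8) f := by
  obtain ⟨m, rfl⟩ : ∃ m, M = m + 1 := ⟨M - 1, by omega⟩
  have hm : 0 < m := by omega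
  have hm1 : (1 : ℝ) ≤ m := by exact_mod_cast hm
  obtain ⟨B, hB, hdisj, hv⟩ := exists_disjoint_boxes hd (Fin m × Bool)
    (v := 1 / (m * L)) (by positivity)
  -- The functions are fixed before `n`; only `ε` depends on it.
  refine ⟨hypercubeSpan B, memLp_hypercubeSpan hB hv, fun n hn hnM T hT => ?_⟩
  -- With `ε² = κM/n`, the bound `κ ≤ 1/c₀` gives `ε ≤ 1` in the range `M ≤ c₀n`, and `κ ≤ 1/8`
  -- gives `nε² ≤ m/4` because `m + 1 ≤ 2m`.
  set κ := min (1 / 8) (1 / c₀) with hκ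
  have hκ0 : 0 < κ := lt_min (by norm_num) (by positivity)
  have hn1 : (1 : ℝ) ≤ n := by exact_mod_cast hn
  have hn0 : (0 : ℝ) < n := by linarith
  push_cast at hnM
  have hsq : Real.sqrt (κ * (m + 1) / n) ^ 2 = κ * (m + 1) / n := Real.sq_sqrt (by positivity)
  have hε1 : Real.sqrt (κ * (m + 1) / n) ≤ 1 := by
    rw [Real.sqrt_le_one, div_le_one hn0]
    calc κ * (m + 1) ≤ 1 / c₀ * (c₀ * n) := by
          gcongr
          exact min_le_right _ _
      _ = n := by field_simp
  have hεn : n * Real.sqrt (κ * (m + 1) / n) ^ 2 ≤ m / 4 := by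
    rw [hsq, mul_div_cancel₀ _ hn0.ne']
    have : κ ≤ 1 / 8 := min_le_left _ _
    nlinarith
  obtain ⟨σ, hσ, hr⟩ := exists_vertex_risk_ge hm hB hdisj hv hL (by field_simp)
    (Real.sqrt_nonneg _) hε1 hεn hT
  refine le_maxExcessRisk hσ (oracleRisk_hypercubeSpan hdisj σ) (by positivity) ?_
  convert hr using 2
  rw [hsq]
  push_cast
  ring

end DensityAggregation

end

theorem corollary3p1 (c₀ : ℝ) (hc₀ : 0 < c₀) :
    ∃ C c : ℝ, 0 < C ∧ 0 < c ∧ ∀ (d : ℕ) (L : ℝ), 1 ≤ d → 0 < L →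
      DensityAggregation.IsOptimalRate (DensityAggregation.boundedDensities d L)
        (fun _ => Set.univ) (fun n M => L * M / n) (fun n M => (M : ℝ) ≤ c₀ * n) C c ∧
      ∀ (M : ℕ), 2 ≤ M →
        ∀ (f : Fin M → DensityAggregation.E d → ℝ) (hf : ∀ j, MemLp (f j) 2 volume)
          (M' : ℕ) (φ : Fin M' → DensityAggregation.E d → ℝ),
          DensityAggregation.IsOrthonormalBasisOfSpan f hf φ →
          DensityAggregation.AttainsRate (DensityAggregation.boundedDensities d L) Set.univ
            (fun n M => L * M / n) C f (DensityAggregation.linearAggregate φ) := by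
  refine ⟨1, min (1 / 8) (1 / c₀) / 8, one_pos, by positivity, fun d L hd hL => ⟨⟨?_, ?_, ?_⟩, ?_⟩⟩
  · intro n M hn hM
    have : (0 : ℝ) < n := by exact_mod_cast hn
    have : (0 : ℝ) < M := by exact_mod_cast (by omega : 0 < M)
    positivity
  · intro M _ f hf
    obtain ⟨M', φ, h⟩ := DensityAggregation.exists_isOrthonormalBasisOfSpan f hf
    exact ⟨_, DensityAggregation.attainsRate_linearAggregate hL.le hf h⟩
  · exact fun M hM => DensityAggregation.exists_rateUnimprovable hc₀ hd hL hM
  · exact fun M _ f hf M' φ h => DensityAggregation.attainsRate_linearAggregate hL.le hf h
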